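/- Let $S$ be an inverse semigroup, with $s^*$ denoting the inverse of $s$, let $E(S)$ be its semilattice of idempotents (ordered by $e\le f$ iff $ef=e$), and for $e\in E(S)$ let $G_e=\{s\in S\mid s^*s=e=ss^*\}$ be the maximal subgroup of $S$ at $e$. Let $R$ be a commutative ring with unit. A (not necessarily unital) ring $A$ is called prime if $A\neq 0$ and $IJ=0$ implies $I=0$ or $J=0$ for all two-sided ideals $I,J$ of $A$. Let $RS$ be the semigroup algebra and, if $S$ has a zero element $z$, let $R_0S=RS/Rz$ be the contracted semigroup algebra. Call $S$ bisimple if for all $e,f\in E(S)$ there is $s\in S$ with $s^*s=e$ and $ss^*=f$; if $S$ has a zero, call $S$ $0$-bisimple if this holds for all nonzero $e,f\in E(S)$. Call $E(S)$ pseudofinite if, for each $e\in E(S)$, the set $\{f\in E(S)\mid f<e\}$ is finitely generated as a lower set. 1. If $S$ is bisimple and $RG_e$ is prime for some $e\in E(S)$, then $RS$ is prime. Conversely, if $E(S)$ is pseudofinite and $RS$ is prime, then $E(S)\ne\emptyset$, $S$ is bisimple, and $RG_e$ is prime for every $e\in E(S)$. 2. Suppose $S$ has a zero element. If $S$ is $0$-bisimple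 and $RG_e$ is prime for some nonzero $e\in E(S)$, then $R_0S$ is prime. Conversely, if $E(S)$ is pseudofinite and $R_0S$ is prime, then $S$ has a nonzero idempotent, $S$ is $0$-bisimple, and $RG_e$ is prime for every nonzero $e\in E(S)$. -/

import Mathlib

/-- An inverse semigroup: a semigroup in which every `s` has exactly one `s⁻¹` with
`s * s⁻¹ * s = s` and `s⁻¹ * s * s⁻¹ = s⁻¹`. -/
class InverseSemigroup (S : Type*) extends Semigroup S, Inv S where
  mul_inv_mul : ∀ s : S, s * s⁻¹ * s = s
  inv_mul_inv : ∀ s : S, s⁻¹ * s * s⁻¹ = s⁻¹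
  inv_unique : ∀ s t : S, s * t * s = s → t * s * t = t → t = s⁻¹

namespace InverseSemigroup

variable {S : Type*} [InverseSemigroup S]

theorem inv_inv' (s : S) : s⁻¹⁻¹ = s :=
  (inv_unique s⁻¹ s (inv_mul_inv s) (mul_inv_mul s)).symm

theorem inv_of_idem {e : S} (he : e * e = e) : e⁻¹ = e :=
  (inv_unique e e (by rw [he, he]) (by rw [he, he])).symm

theorem mul_idem {e f : S} (he : e * e = e) (hf : f * f = f) :
    (e * f) * (e * f) = e * f := by
  have h1 := mul_inv_mul (e * f)
  have h2 := inv_mul_inv (e * f)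
  generalize hx : (e * f)⁻¹ = x at h1 h2
  have h3 : f * x * e = x := by
    rw [← hx]
    apply inv_unique
    · rw [hx]
      calc e * f * (f * x * e) * (e * f) = e * (f * f) * x * (e * e) * f := by
            simp only [mul_assoc]
        _ = e * f := by rw [he, hf]; simpa only [mul_assoc] using h1
    · rw [hx]
      calc f * x * e * (e * f) * (f * x * e) = f * (x * ((e * e) * (f * f)) * x) * e := by
            simp only [mul_assoc]
        _ = f * x * e := by rw [he, hf, h2]
  have h4 : x * x = x := by
    calc x * x = (f * x * e) * (f * x * e) := by rw [h3]
      _ = f * (x * (e * f) * x) * e := by simp only [mul_assoc]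
      _ = x := by rw [h2, h3]
  have h5 : e * f = x := by
    rw [← inv_of_idem h4, ← hx, inv_inv']
  rw [h5, h4]

/-- Idempotents commute. -/
theorem idem_comm {e f : S} (he : e * e = e) (hf : f * f = f) : e * f = f * e := by
  have h1 := mul_idem he hf
  have h2 := mul_idem hf he
  have h3 : f * e = (e * f)⁻¹ := by
    apply inv_unique
    · calc e * f * (f * e) * (e * f) = e * (f * f) * (e * e) * f := by simp only [mul_assoc]
        _ = e * f := by rw [he, hf]; simpa only [mul_assoc] using h1
    · calc f * e * (e * f) * (f * e) = f * (e * e) * (f * f) * e := by simp only [mul_assoc]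
        _ = f * e := by rw [he, hf]; simpa only [mul_assoc] using h2
  rw [h3, inv_of_idem h1]

variable (S) in
/-- The set `E(S)` of idempotents. -/
@[ext]
structure Idem where
  val : S
  mul_self : val * val = val

/-- The order on `E(S)`: `e ≤ f` if and only if `e * f = e`. -/
instance : PartialOrder (Idem S) where
  le e f := e.val * f.val = e.val
  le_refl e := e.mul_self
  le_trans e f g hef hfg := by
    calc e.val * g.val = e.val * f.val * g.val := by rw [show e.val * f.val = e.val from hef]
      _ = e.val * f.val := by rw [mul_assoc, show f.val * g.val = f.val from hfg]
      _ = e.val := hef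
  le_antisymm e f hef hfe := Idem.ext <| by
    calc e.val = e.val * f.val := Eq.symm hef
      _ = f.val * e.val := idem_comm e.mul_self f.mul_self
      _ = f.val := hfe

/-- The maximal subgroup `G_e` of `S` at the idempotent `e`. -/
@[ext]
structure MaximalSubgroup (e : Idem S) where
  val : S
  inv_mul : val⁻¹ * val = e.val
  mul_inv : val * val⁻¹ = e.val

namespace MaximalSubgroup

variable {e : Idem S}

theorem one_mul' (s : MaximalSubgroup e) : e.val * s.val = s.val := by
  rw [← s.mul_inv]
  exact mul_inv_mul s.val

theorem mul_one' (s : MaximalSubgroup e) : s.val * e.val = s.val := by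
  rw [← s.inv_mul, ← mul_assoc, mul_inv_mul]

theorem one_mul_inv (s : MaximalSubgroup e) : e.val * s.val⁻¹ = s.val⁻¹ := by
  rw [← s.inv_mul, inv_mul_inv]

theorem mul_mul_inv (s t : MaximalSubgroup e) : s.val * t.val * (t.val⁻¹ * s.val⁻¹) = e.val := by
  calc s.val * t.val * (t.val⁻¹ * s.val⁻¹) = s.val * (t.val * t.val⁻¹) * s.val⁻¹ := by simp only [mul_assoc]
    _ = e.val := by rw [t.mul_inv, mul_one', s.mul_inv]

theorem inv_mul_mul (s t : MaximalSubgroup e) : t.val⁻¹ * s.val⁻¹ * (s.val * t.val) = e.val := by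
  calc t.val⁻¹ * s.val⁻¹ * (s.val * t.val) = t.val⁻¹ * ((s.val⁻¹ * s.val) * t.val) := by simp only [mul_assoc]
    _ = e.val := by rw [s.inv_mul, one_mul', t.inv_mul]

theorem mul_inv' (s t : MaximalSubgroup e) : (s.val * t.val)⁻¹ = t.val⁻¹ * s.val⁻¹ := by
  symm
  apply inv_unique
  · rw [mul_mul_inv, ← mul_assoc, one_mul']
  · rw [inv_mul_mul, ← mul_assoc, one_mul_inv]

/-- The group structure of `G_e`: multiplication and inversion are those of `S`, the identity
is `e`. -/
instance : Group (MaximalSubgroup e) where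
  mul s t := ⟨s.val * t.val, by rw [mul_inv', inv_mul_mul], by rw [mul_inv', mul_mul_inv]⟩
  one := ⟨e.val, by rw [inv_of_idem e.mul_self, e.mul_self], by rw [inv_of_idem e.mul_self, e.mul_self]⟩
  inv s := ⟨s.val⁻¹, by rw [inv_inv', s.mul_inv], by rw [inv_inv', s.inv_mul]⟩
  mul_assoc s t u := MaximalSubgroup.ext (mul_assoc s.val t.val u.1)
  one_mul s := MaximalSubgroup.ext (one_mul' s)
  mul_one s := MaximalSubgroup.ext (mul_one' s)
  inv_mul_cancel s := MaximalSubgroup.ext s.inv_mul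

end MaximalSubgroup

variable (S) in
/-- `S` is bisimple: for all idempotents `e`, `f` there is `s` with `s⁻¹ * s = e` and
`s * s⁻¹ = f`. -/
def IsBisimple : Prop := ∀ e f : Idem S, ∃ s : S, s⁻¹ * s = e.val ∧ s * s⁻¹ = f.val

/-- `z` is a zero element of `S`. -/
def IsZeroElement (z : S) : Prop := ∀ s : S, z * s = z ∧ s * z = z

/-- `S`, with zero element `z`, is `0`-bisimple: for all nonzero idempotents `e`, `f` there is `s`
with `s⁻¹ * s = e` and `s * s⁻¹ = f`. -/
def IsZeroBisimple (z : S) : Prop :=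
  ∀ e f : Idem S, e.val ≠ z → f.val ≠ z → ∃ s : S, s⁻¹ * s = e.val ∧ s * s⁻¹ = f.val

theorem mul_single_zero (R : Type*) [CommRing R] {z : S} (hz : IsZeroElement z)
    (x : MonoidAlgebra R S) (r : R) :
    (∃ c, MonoidAlgebra.single z c = x * MonoidAlgebra.single z r) ∧
      ∃ c, MonoidAlgebra.single z c = MonoidAlgebra.single z r * x := by
  induction x using MonoidAlgebra.induction_linear with
  | zero => exact ⟨⟨0, by simp⟩, ⟨0, by simp⟩⟩
  | add x y hx hy =>
    obtain ⟨⟨a, ha⟩, ⟨a', ha'⟩⟩ := hx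
    obtain ⟨⟨b, hb⟩, ⟨b', hb'⟩⟩ := hy
    exact ⟨⟨a + b, by rw [MonoidAlgebra.single_add, ha, hb, add_mul]⟩,
      ⟨a' + b', by rw [MonoidAlgebra.single_add, ha', hb', mul_add]⟩⟩
  | single s a =>
    exact ⟨⟨a * r, by rw [MonoidAlgebra.single_mul_single, (hz s).2]⟩,
      ⟨r * a, by rw [MonoidAlgebra.single_mul_single, (hz s).1]⟩⟩

/-- The ideal `Rz` of the semigroup algebra `RS`, for a zero element `z` of `S`. -/
noncomputable def zeroIdeal (R : Type*) [CommRing R] {z : S} (hz : IsZeroElement z) :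
    TwoSidedIdeal (MonoidAlgebra R S) :=
  .mk' (Set.range (fun r : R => MonoidAlgebra.single z r))
    (Set.mem_range.2 ⟨0, by simp⟩)
    (by rintro _ _ ⟨a, rfl⟩ ⟨b, rfl⟩; exact ⟨a + b, by simp⟩)
    (by rintro _ ⟨a, rfl⟩; exact ⟨-a, by simp⟩)
    (by rintro x _ ⟨a, rfl⟩; exact (mul_single_zero R hz x a).1)
    (by rintro _ y ⟨a, rfl⟩; exact (mul_single_zero R hz y a).2)

theorem mem_zeroIdeal (R : Type*) [CommRing R] {z : S} (hz : IsZeroElement z)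
    {x : MonoidAlgebra R S} : x ∈ zeroIdeal R hz ↔ ∃ r : R, MonoidAlgebra.single z r = x :=
  TwoSidedIdeal.mem_mk' _ _ _ _ _ _ x

/-- The contracted semigroup algebra `R₀S = RS / Rz`. -/
abbrev ContractedAlgebra (R : Type*) [CommRing R] {z : S} (hz : IsZeroElement z) : Type _ :=
  (zeroIdeal R hz).ringCon.Quotient

end InverseSemigroup

/-- A semilattice is pseudofinite if, for every `e`, the set of elements strictly below `e` is
finitely generated as a lower set. -/
def IsPseudofinite (E : Type*) [PartialOrder E] : Prop :=
  ∀ e : E, ∃ F : Finset E, Set.Iio e = (lowerClosure (F : Set E) : Set E)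

/-- A (not necessarily unital) ring is prime if `0` is a prime ideal: the ring is nonzero, and
`I * J = 0` implies `I = 0` or `J = 0` for all two-sided ideals `I`, `J`. -/
def IsPrimeRing (A : Type*) [NonUnitalRing A] : Prop :=
  Nontrivial A ∧ ∀ I J : TwoSidedIdeal A,
    (∀ a ∈ I, ∀ b ∈ J, a * b = 0) → I = ⊥ ∨ J = ⊥

/-! The semigroup algebra `RS` and the contracted algebra `R₀S` are both the quotient of `RS` by
the span of a set `Z` of zero elements of `S`, empty or equal to `{z}`; both parts of the theorem
are proved at once for such quotients, here called contractions. Primeness is used in the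
elementwise form `a A b = 0 → a = 0 ∨ b = 0`, which is equivalent to the ideal form in every
nonzero nonunital ring.

Let `S` be bisimple off `Z`, let `RG_e` be prime and let `a`, `b` be nonzero in the contraction. By
`IsContraction.exists_compress` one can multiply each of them on both sides to obtain an element of
`e RS e` which is the sum of a nonzero element of `RG_e` and of terms outside `G_e` whose domain is
strictly below `e`. Such sums are closed under multiplication, and the component in `RG_e` is
multiplicative on them (`mul_mem_localSpan_and_groupPart_mul`). So if `a A b = 0`, then the two
components annihilate each other through all of `RG_e`, contradicting its primeness. This direction
needs no finiteness: the idempotents along which one compresses are extremal among the finitely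
many that come from the support.

Conversely, if the idempotents below `e` are generated as a lower set by a finite set `F`, the
product `d` of all `e - f` with `f ∈ F` annihilates every idempotent below `e`. It is nonzero, as
its component in `RG_e` is `1`; it commutes with `RG_e`; and `d RS d = d RG_e`
(`IsIsolating.exists_mul_mul_eq`), a copy of `RG_e` inside `RS`. Primeness passes to this corner.
For two idempotents with their `d` and `d'`, the space `d RS d'` vanishes unless they are connected
by an element of `S` (`IsIsolating.mul_single_mul_eq_zero`), so primeness connects them. -/

/-! ### Prime rings elementwise -/

/-- In a prime ring, `a A b = 0` forces `a = 0` or `b = 0`, even without a unit. -/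
theorem IsPrimeRing.eq_zero_or_eq_zero {A : Type*} [NonUnitalRing A] (hA : IsPrimeRing A)
    {a b : A} (h : ∀ x, a * x * b = 0) : a = 0 ∨ b = 0 := by
  obtain ⟨hnt, hprime⟩ := hA
  by_contra! hab
  obtain ⟨ha, hb⟩ := hab
  let J : TwoSidedIdeal A := .mk' {y | ∀ x, a * x * y = 0}
    (by simp) (fun {y z} hy hz x => by rw [mul_add, hy x, hz x, add_zero])
    (fun {y} hy x => by rw [mul_neg, hy x, neg_zero])
    (fun {w y} hy x => by rw [← mul_assoc, mul_assoc a x w, hy])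
    (fun {y w} hy x => by rw [← mul_assoc, hy, zero_mul])
  have hJ : ∀ y, y ∈ J ↔ ∀ x, a * x * y = 0 := fun y => TwoSidedIdeal.mem_mk' _ _ _ _ _ _ y
  let I : TwoSidedIdeal A := .mk' {x | ∀ c, ∀ y ∈ J, x * c * y = 0}
    (by simp) (fun {y z} hy hz c x hx => by rw [add_mul, add_mul, hy c x hx, hz c x hx, add_zero])
    (fun {y} hy c x hx => by rw [neg_mul, neg_mul, hy c x hx, neg_zero])
    (fun {w y} hy c x hx => by rw [mul_assoc w, mul_assoc w, hy c x hx, mul_zero])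
    (fun {y w} hy c x hx => by rw [mul_assoc y w c, hy _ x hx])
  have hI : ∀ x, x ∈ I ↔ ∀ c, ∀ y ∈ J, x * c * y = 0 :=
    fun y => TwoSidedIdeal.mem_mk' _ _ _ _ _ _ y
  -- `A` need not be unital, so `I * J = 0` is not immediate: only `I * A * J = 0` is.
  let K : TwoSidedIdeal A := .mk' {y | ∀ x ∈ I, x * y = 0}
    (by simp) (fun {y z} hy hz x hx => by rw [mul_add, hy x hx, hz x hx, add_zero])
    (fun {y} hy x hx => by rw [mul_neg, hy x hx, neg_zero])
    (fun {w y} hy x hx => by rw [← mul_assoc, hy _ (I.mul_mem_right _ _ hx)])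
    (fun {y w} hy x hx => by rw [← mul_assoc, hy x hx, zero_mul])
  have hK : ∀ y, y ∈ K ↔ ∀ x ∈ I, x * y = 0 := fun y => TwoSidedIdeal.mem_mk' _ _ _ _ _ _ y
  have hI0 : I ≠ ⊥ := fun h0 => ha <| by
    have : a ∈ I := (hI a).2 fun c y hy => (hJ y).1 hy c
    rwa [h0, TwoSidedIdeal.mem_bot] at this
  have hJ0 : J ≠ ⊥ := fun h0 => hb <| by
    have : b ∈ J := (hJ b).2 h
    rwa [h0, TwoSidedIdeal.mem_bot] at this
  have hK0 : K = ⊥ := (hprime I K fun x hx y hy => (hK y).1 hy x hx).resolve_left hI0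
  have hAJ : ∀ c ∈ (⊤ : TwoSidedIdeal A), ∀ y ∈ J, c * y = 0 := fun c _ y hy => by
    have : c * y ∈ K := (hK _).2 fun x hx => by rw [← mul_assoc, (hI x).1 hx c y hy]
    rwa [hK0, TwoSidedIdeal.mem_bot] at this
  rcases hprime ⊤ J hAJ with h0 | h0
  · exact ha <| (TwoSidedIdeal.mem_bot A).1 (h0 ▸ TwoSidedIdeal.mem_top A)
  · exact hJ0 h0

theorem isPrimeRing_of_eq_zero_or_eq_zero {A : Type*} [NonUnitalRing A] [Nontrivial A]
    (h : ∀ a b : A, (∀ x, a * x * b = 0) → a = 0 ∨ b = 0) : IsPrimeRing A := by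
  refine ⟨inferInstance, fun I J hIJ => ?_⟩
  by_contra! hne
  have key : ∀ I : TwoSidedIdeal A, I ≠ ⊥ → ∃ a ∈ I, a ≠ 0 := fun I hI => by
    by_contra! h0
    exact hI (TwoSidedIdeal.ext fun x => by
      rw [TwoSidedIdeal.mem_bot]
      exact ⟨h0 x, fun hx => hx ▸ I.zero_mem⟩)
  obtain ⟨a, haI, ha⟩ := key I hne.1
  obtain ⟨b, hbJ, hb⟩ := key J hne.2
  rcases h a b fun x => hIJ _ (I.mul_mem_right _ _ haI) b hbJ with h | h
  exacts [ha h, hb h]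

namespace InverseSemigroup

/-! ### Arithmetic in an inverse semigroup -/

section Semigroup

variable {S : Type*} [InverseSemigroup S]

theorem inv_mul_self_idem (s : S) : s⁻¹ * s * (s⁻¹ * s) = s⁻¹ * s := by
  rw [← mul_assoc, inv_mul_inv]

theorem mul_inv_self_idem (s : S) : s * s⁻¹ * (s * s⁻¹) = s * s⁻¹ := by
  rw [← mul_assoc, mul_inv_mul]

theorem mul_inv_rev' (s t : S) : (s * t)⁻¹ = t⁻¹ * s⁻¹ := by
  have hc := idem_comm (inv_mul_self_idem s) (mul_inv_self_idem t)
  symm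
  apply inv_unique
  · calc s * t * (t⁻¹ * s⁻¹) * (s * t) = s * (t * t⁻¹ * (s⁻¹ * s)) * t := by simp only [mul_assoc]
      _ = s * s⁻¹ * s * (t * t⁻¹ * t) := by rw [← hc]; simp only [mul_assoc]
      _ = s * t := by rw [mul_inv_mul, mul_inv_mul]
  · calc t⁻¹ * s⁻¹ * (s * t) * (t⁻¹ * s⁻¹) = t⁻¹ * (s⁻¹ * s * (t * t⁻¹)) * s⁻¹ := by
          simp only [mul_assoc]
      _ = t⁻¹ * t * t⁻¹ * (s⁻¹ * s * s⁻¹) := by rw [hc]; simp only [mul_assoc]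
      _ = t⁻¹ * s⁻¹ := by rw [inv_mul_inv, inv_mul_inv]

/-- The idempotent `s⁻¹ * s`. -/
def domIdem (s : S) : Idem S := ⟨s⁻¹ * s, inv_mul_self_idem s⟩

/-- The idempotent `s * s⁻¹`. -/
def ranIdem (s : S) : Idem S := ⟨s * s⁻¹, mul_inv_self_idem s⟩

theorem le_iff_mul_eq {e f : Idem S} : e ≤ f ↔ e.val * f.val = e.val := Iff.rfl

theorem le_iff_mul_eq' {e f : Idem S} : e ≤ f ↔ f.val * e.val = e.val := by
  rw [le_iff_mul_eq, idem_comm e.mul_self f.mul_self]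

theorem domIdem_le {s : S} {e : Idem S} (h : s * e.val = s) : domIdem s ≤ e := by
  rw [le_iff_mul_eq, domIdem, mul_assoc, h]

theorem ranIdem_le {s : S} {e : Idem S} (h : e.val * s = s) : ranIdem s ≤ e := by
  rw [le_iff_mul_eq', ranIdem, ← mul_assoc, h]

theorem conj_idem (s : S) (f : Idem S) :
    s * f.val * s⁻¹ * (s * f.val * s⁻¹) = s * f.val * s⁻¹ := by
  calc s * f.val * s⁻¹ * (s * f.val * s⁻¹) = s * (f.val * (s⁻¹ * s)) * f.val * s⁻¹ := by
        simp only [mul_assoc]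
    _ = s * s⁻¹ * s * (f.val * f.val) * s⁻¹ := by
        rw [idem_comm f.mul_self (inv_mul_self_idem s)]; simp only [mul_assoc]
    _ = s * f.val * s⁻¹ := by rw [mul_inv_mul, f.mul_self]

/-- `s` lies in `e S e`, and in `G_e` as soon as its domain idempotent is `e`. The elements with
this property form a monoid with identity `e`, of which those outside `G_e` are an ideal; so taking
the part in `G_e` is multiplicative on their linear combinations. -/
structure IsLocal (e : Idem S) (s : S) : Prop where
  left : e.val * s = s
  right : s * e.val = s
  ran : s⁻¹ * s = e.val → s * s⁻¹ = e.val

theorem MaximalSubgroup.isLocal {e : Idem S} (g : MaximalSubgroup e) : IsLocal e g.val :=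
  ⟨g.one_mul', g.mul_one', fun _ => g.mul_inv⟩

theorem Idem.isLocal {e f : Idem S} (h : f ≤ e) : IsLocal e f.val := by
  refine ⟨le_iff_mul_eq'.1 h, h, fun h1 => ?_⟩
  rwa [inv_of_idem f.mul_self] at h1 ⊢

theorem IsLocal.of_mul {e : Idem S} {s t : S} (hs : IsLocal e s) (ht : IsLocal e t)
    (h : (s * t)⁻¹ * (s * t) = e.val) : s⁻¹ * s = e.val ∧ t⁻¹ * t = e.val := by
  have h1 : t⁻¹ * (s⁻¹ * s) * t = e.val := by
    rw [← h, mul_inv_rev']; simp only [mul_assoc]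
  have h2 : t⁻¹ * t = e.val := by
    have h3 : e.val * (t⁻¹ * t) = e.val := by
      rw [← h1, mul_assoc, ← mul_assoc t, mul_inv_mul]
    rw [← h3, idem_comm e.mul_self (inv_mul_self_idem t), mul_assoc, ht.right]
  have h4 := ht.ran h2
  refine ⟨?_, h2⟩
  have h5 : e.val * (s⁻¹ * s) = s⁻¹ * s := by
    rw [idem_comm e.mul_self (inv_mul_self_idem s), mul_assoc, hs.right]
  calc s⁻¹ * s = t * t⁻¹ * (s⁻¹ * s) * (t * t⁻¹) := by rw [h4, h5, mul_assoc, hs.right]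
    _ = t * (t⁻¹ * (s⁻¹ * s) * t) * t⁻¹ := by simp only [mul_assoc]
    _ = e.val := by rw [h1, ht.right, h4]

theorem IsLocal.mul {e : Idem S} {s t : S} (hs : IsLocal e s) (ht : IsLocal e t) :
    IsLocal e (s * t) := by
  refine ⟨by rw [← mul_assoc, hs.left], by rw [mul_assoc, ht.right], fun h => ?_⟩
  obtain ⟨h1, h2⟩ := hs.of_mul ht h
  calc s * t * (s * t)⁻¹ = s * (t * t⁻¹) * s⁻¹ := by rw [mul_inv_rev']; simp only [mul_assoc]
    _ = e.val := by rw [ht.ran h2, hs.right, hs.ran h1]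

/-- A product of local elements is in `G_e` only if both factors are. -/
theorem IsLocal.mul_mem_iff {e : Idem S} {s t : S} (hs : IsLocal e s) (ht : IsLocal e t) :
    (s * t)⁻¹ * (s * t) = e.val ↔ s⁻¹ * s = e.val ∧ t⁻¹ * t = e.val := by
  refine ⟨hs.of_mul ht, fun ⟨h1, h2⟩ => ?_⟩
  calc (s * t)⁻¹ * (s * t) = t⁻¹ * (s⁻¹ * s * t) := by rw [mul_inv_rev']; simp only [mul_assoc]
    _ = e.val := by rw [h1, ht.left, h2]

/-- Compressing `s` to `e S e` along `e ~ u` on the left and `e ~ v` on the right: if the result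
has domain `e`, then `v` is below `s⁻¹ * u * s`. -/
theorem le_of_compress {e : S} {a b s u v : S} (ha' : a * a⁻¹ = u)
    (hb : b⁻¹ * b = e) (hb' : b * b⁻¹ = v)
    (h : (a⁻¹ * s * b)⁻¹ * (a⁻¹ * s * b) = e) : v * (s⁻¹ * u * s) = v := by
  have h1 : b⁻¹ * (s⁻¹ * u * s) * b = e := by
    rw [← h, mul_inv_rev', mul_inv_rev', inv_inv', ← ha']; simp only [mul_assoc]
  have hv : v * v = v := by rw [← hb', mul_inv_self_idem]
  have hu : u * u = u := by rw [← ha', mul_inv_self_idem]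
  have hx : s⁻¹ * u * s * (s⁻¹ * u * s) = s⁻¹ * u * s := by
    simpa only [inv_inv'] using conj_idem s⁻¹ ⟨u, hu⟩
  calc v * (s⁻¹ * u * s) = v * (v * (s⁻¹ * u * s)) := by rw [← mul_assoc v v, hv]
    _ = v * (s⁻¹ * u * s) * v := idem_comm hv (mul_idem hv hx)
    _ = b * (b⁻¹ * (s⁻¹ * u * s) * b) * b⁻¹ := by rw [← hb']; simp only [mul_assoc]
    _ = v := by rw [h1, ← hb, ← mul_assoc, mul_inv_mul, hb']

theorem mul_inv_mul_self_of_conj {s u v : S} (h : v * (s⁻¹ * u * s) = v) :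
    v * (s⁻¹ * s) = v := by
  calc v * (s⁻¹ * s) = v * (s⁻¹ * u * s) * (s⁻¹ * s) := by rw [h]
    _ = v * (s⁻¹ * u * (s * s⁻¹ * s)) := by simp only [mul_assoc]
    _ = v := by rw [mul_inv_mul, h]

theorem mul_inv_self_mul_of_conj {s v : S} {u : Idem S} (h : v * (s⁻¹ * u.val * s) = v)
    (hs : s⁻¹ * s = v) : s * s⁻¹ * u.val = s * s⁻¹ := by
  symm
  calc s * s⁻¹ = s * (s⁻¹ * s) * s⁻¹ := by rw [← mul_assoc, mul_inv_mul]
    _ = s * (s⁻¹ * s * (s⁻¹ * u.val * s)) * s⁻¹ := by rw [hs, h]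
    _ = s * s⁻¹ * (s * s⁻¹) * (u.val * (s * s⁻¹)) := by simp only [mul_assoc]
    _ = s * s⁻¹ * u.val := by
      rw [idem_comm u.mul_self (mul_inv_self_idem s), mul_inv_self_idem, ← mul_assoc,
        mul_inv_self_idem]

theorem MaximalSubgroup.conj_lt {e f : Idem S} (g : MaximalSubgroup e) (hf : f < e) :
    (⟨g.val * f.val * g.val⁻¹, conj_idem g.val f⟩ : Idem S) < e := by
  refine lt_of_le_of_ne ?_ fun h => hf.ne (Idem.ext ?_)
  · rw [le_iff_mul_eq']
    exact by rw [← mul_assoc, ← mul_assoc, g.one_mul']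
  · have h1 : g.val * f.val * g.val⁻¹ = e.val := congrArg Idem.val h
    calc f.val = e.val * f.val * e.val := by rw [le_iff_mul_eq'.1 hf.le, le_iff_mul_eq.1 hf.le]
      _ = g.val⁻¹ * (g.val * f.val * g.val⁻¹) * g.val := by
          rw [← g.inv_mul]; simp only [mul_assoc]
      _ = e.val := by rw [h1, mul_assoc, g.one_mul', g.inv_mul]

end Semigroup

/-! ### The part of an element of `RS` in `RG_e` -/

section Algebra

open MonoidAlgebra

variable {S : Type*} [InverseSemigroup S] {R : Type*} [CommRing R]

namespace MaximalSubgroup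

/-- The inclusion `G_e → S`. -/
def incl (e : Idem S) : MaximalSubgroup e →ₙ* S where
  toFun g := g.val
  map_mul' _ _ := rfl

theorem incl_injective (e : Idem S) : Function.Injective (incl e) := fun _ _ h =>
  MaximalSubgroup.ext h

end MaximalSubgroup

open MaximalSubgroup

variable (R) in
/-- The embedding of `RG_e` into `RS`. -/
noncomputable abbrev groupIncl (e : Idem S) :
    MonoidAlgebra R (MaximalSubgroup e) →ₙ+* MonoidAlgebra R S :=
  mapDomainNonUnitalRingHom R (incl e)

variable (R) in
/-- The part in `RG_e` of an element of `RS`. -/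
noncomputable abbrev groupPart (e : Idem S) :
    MonoidAlgebra R S →+ MonoidAlgebra R (MaximalSubgroup e) :=
  comapDomainAddMonoidHom (incl e) (incl_injective e)

theorem coeff_groupPart (e : Idem S) (x : MonoidAlgebra R S) (g : MaximalSubgroup e) :
    (groupPart R e x).coeff g = x.coeff g.val := by
  simp [comapDomain, incl]

theorem groupPart_single_val {e : Idem S} (g : MaximalSubgroup e) (r : R) :
    groupPart R e (single g.val r) = single g r :=
  comapDomain_single_map (incl e) (incl_injective e) g r

theorem groupPart_single_of_ne {e : Idem S} {s : S} (hs : s⁻¹ * s ≠ e.val) (r : R) :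
    groupPart R e (single s r) = 0 :=
  comapDomain_single_of_not_mem_range (by rintro ⟨g, rfl⟩; exact hs g.inv_mul)
    (incl_injective e)

theorem groupIncl_single {e : Idem S} (g : MaximalSubgroup e) (r : R) :
    groupIncl R e (single g r) = single g.val r :=
  mapDomain_single

theorem groupPart_groupIncl (e : Idem S) (x : MonoidAlgebra R (MaximalSubgroup e)) :
    groupPart R e (groupIncl R e x) = x := by
  induction x using induction_linear with
  | zero => simp only [map_zero]
  | add x y hx hy => rw [map_add, map_add, hx, hy]
  | single g r => rw [groupIncl_single, groupPart_single_val]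

variable (R) in
/-- The linear combinations of local elements at `e`. -/
noncomputable def localSpan (e : Idem S) : AddSubgroup (MonoidAlgebra R S) :=
  AddSubgroup.closure {x | ∃ s r, IsLocal e s ∧ single s r = x}

theorem single_mem_localSpan {e : Idem S} {s : S} (hs : IsLocal e s) (r : R) :
    single s r ∈ localSpan R e :=
  AddSubgroup.subset_closure ⟨s, r, hs, rfl⟩

theorem groupIncl_mem_localSpan (e : Idem S) (x : MonoidAlgebra R (MaximalSubgroup e)) :
    groupIncl R e x ∈ localSpan R e := by
  induction x using induction_linear with
  | zero => rw [map_zero]; exact zero_mem _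
  | add x y hx hy => rw [map_add]; exact add_mem hx hy
  | single g r => rw [groupIncl_single]; exact single_mem_localSpan g.isLocal r

/-- On linear combinations of local elements, taking the part in `RG_e` is multiplicative. -/
theorem mul_mem_localSpan_and_groupPart_mul {e : Idem S} {x y : MonoidAlgebra R S}
    (hx : x ∈ localSpan R e) (hy : y ∈ localSpan R e) :
    x * y ∈ localSpan R e ∧ groupPart R e (x * y) = groupPart R e x * groupPart R e y := by
  induction hx using AddSubgroup.closure_induction with
  | zero => simp only [zero_mul, map_zero, zero_mem, and_self]
  | add x x' _ _ h h' =>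
    rw [add_mul, map_add, map_add, add_mul, h.2, h'.2]
    exact ⟨add_mem h.1 h'.1, rfl⟩
  | neg x _ h =>
    rw [neg_mul, map_neg, map_neg, neg_mul, h.2]
    exact ⟨neg_mem h.1, rfl⟩
  | mem x hx =>
    obtain ⟨s, r, hs, rfl⟩ := hx
    induction hy using AddSubgroup.closure_induction with
    | zero => simp only [mul_zero, map_zero, zero_mem, and_self]
    | add y y' _ _ h h' =>
      rw [mul_add, map_add, map_add, mul_add, h.2, h'.2]
      exact ⟨add_mem h.1 h'.1, rfl⟩
    | neg y _ h =>
      rw [mul_neg, map_neg, map_neg, mul_neg, h.2]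
      exact ⟨neg_mem h.1, rfl⟩
    | mem y hy =>
      obtain ⟨t, r', ht, rfl⟩ := hy
      rw [single_mul_single]
      refine ⟨single_mem_localSpan (hs.mul ht) _, ?_⟩
      have hst := hs.mul_mem_iff ht
      by_cases h1 : s⁻¹ * s = e.val
      · by_cases h2 : t⁻¹ * t = e.val
        · let g : MaximalSubgroup e := ⟨s, h1, hs.ran h1⟩
          let k : MaximalSubgroup e := ⟨t, h2, ht.ran h2⟩
          calc groupPart R e (single (g * k).val (r * r')) = single (g * k) (r * r') :=
                groupPart_single_val _ _
            _ = single g r * single k r' := (single_mul_single ..).symm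
            _ = groupPart R e (single g.val r) * groupPart R e (single k.val r') := by
                rw [groupPart_single_val, groupPart_single_val]
        · rw [groupPart_single_of_ne h2, groupPart_single_of_ne (by rw [Ne, hst]; tauto), mul_zero]
      · rw [groupPart_single_of_ne h1, groupPart_single_of_ne (by rw [Ne, hst]; tauto), zero_mul]

/-! ### Quotients of `RS` by the span of zero elements -/

/-- `q` exhibits `A` as the quotient of `RS` by the span of a set `Z` of zero elements of `S`.
With `Z` empty this is `RS` itself, with `Z` the zero of `S` it is `R₀S`. -/
structure IsContraction {A : Type*} [NonUnitalRing A] (Z : Set S)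
    (q : MonoidAlgebra R S →ₙ+* A) : Prop where
  isZero : ∀ z ∈ Z, IsZeroElement z
  surj : Function.Surjective q
  map_eq_zero_iff : ∀ x, q x = 0 ↔ ∀ s ∉ Z, x.coeff s = 0

/-- Any two idempotents outside `Z` are `𝒟`-related. -/
def IsBisimpleOff (Z : Set S) : Prop :=
  ∀ e f : Idem S, e.val ∉ Z → f.val ∉ Z → ∃ s : S, s⁻¹ * s = e.val ∧ s * s⁻¹ = f.val

theorem IsZeroElement.inv_mul_self {z : S} (hz : IsZeroElement z) : z⁻¹ * z = z := (hz _).2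

variable {A : Type*} [NonUnitalRing A] {Z : Set S} {q : MonoidAlgebra R S →ₙ+* A}

theorem IsContraction.domIdem_notMem (hq : IsContraction Z q) {s : S} (hs : s ∉ Z) :
    (domIdem s).val ∉ Z := fun h => hs <| by
  have h1 := (hq.isZero _ h s).2
  rw [domIdem, ← mul_assoc, mul_inv_mul] at h1
  rwa [h1]

theorem IsContraction.ranIdem_notMem (hq : IsContraction Z q) {s : S} (hs : s ∉ Z) :
    (ranIdem s).val ∉ Z := fun h => hs <| by
  have h1 := (hq.isZero _ h s).1
  rw [ranIdem, mul_inv_mul] at h1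
  rwa [h1]

theorem IsContraction.val_notMem (hq : IsContraction Z q) {e : Idem S} (he : e.val ∉ Z)
    (g : MaximalSubgroup e) : g.val ∉ Z := fun h => he <| by
  rw [← g.inv_mul, (hq.isZero _ h).inv_mul_self]
  exact h

theorem IsContraction.groupPart_eq_zero (hq : IsContraction Z q) {e : Idem S} (he : e.val ∉ Z)
    {x : MonoidAlgebra R S} (hx : q x = 0) : groupPart R e x = 0 := by
  ext g
  rw [coeff_groupPart, (hq.map_eq_zero_iff x).1 hx _ (hq.val_notMem he g)]
  simp

theorem single_mul_mul_single (x : MonoidAlgebra R S) (s t : S) :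
    single s (1 : R) * x * single t 1 = x.coeff.sum fun a r => single (s * a * t) r := by
  conv_lhs => rw [← x.sum_coeff_single]
  rw [Finsupp.sum, Finset.mul_sum, Finset.sum_mul, Finsupp.sum]
  simp [single_mul_single]

/-! ### Leading terms -/

/-- An element nonzero in the contraction can be compressed to `e S e` so that its part in `RG_e`
is not zero: compress along an idempotent `v` maximal among the domains of its support off `Z`, and
`u` minimal among the ranges of those elements of that support that have domain `v`. -/
theorem IsContraction.exists_compress (hq : IsContraction Z q) (hS : IsBisimpleOff Z)
    {e : Idem S} (he : e.val ∉ Z) {b : MonoidAlgebra R S} (hb : q b ≠ 0) :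
    ∃ x y : MonoidAlgebra R S, x * b * y ∈ localSpan R e ∧ groupPart R e (x * b * y) ≠ 0 := by
  classical
  rw [Ne, hq.map_eq_zero_iff] at hb
  push Not at hb
  obtain ⟨s₀, hs₀, hbs₀⟩ := hb
  obtain ⟨t₀, ht₀, hmax⟩ := (b.coeff.support.filter (· ∉ Z)).exists_maximalFor domIdem
    ⟨s₀, by simp [hs₀, hbs₀]⟩
  obtain ⟨t, ht, hmin⟩ := ((b.coeff.support.filter (· ∉ Z)).filter
    (domIdem · = domIdem t₀)).exists_minimalFor ranIdem ⟨t₀, by simpa using ht₀⟩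
  simp only [Finset.mem_filter, Finsupp.mem_support_iff] at ht ht₀ hmax hmin
  obtain ⟨⟨hbt, htZ⟩, htt₀⟩ := ht
  rw [← htt₀] at hmax hmin
  have hvZ := hq.domIdem_notMem htZ
  obtain ⟨α, hα, hα'⟩ := hS e (ranIdem t) he (hq.ranIdem_notMem htZ)
  obtain ⟨β, hβ, hβ'⟩ := hS e (domIdem t) he hvZ
  have heα : e.val * α⁻¹ = α⁻¹ := by rw [← hα, inv_mul_inv]
  have hβe : β * e.val = β := by rw [← hβ, ← mul_assoc, mul_inv_mul]
  have hαu : α⁻¹ * (ranIdem t).val = α⁻¹ := by rw [← hα', ← mul_assoc, inv_mul_inv]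
  -- The elements of the support that survive in `G_e` are `ℋ`-related to `t`.
  have key : ∀ s, b.coeff s ≠ 0 → (α⁻¹ * s * β)⁻¹ * (α⁻¹ * s * β) = e.val →
      domIdem s = domIdem t ∧ ranIdem s = ranIdem t := by
    intro s hs h
    have h1 := le_of_compress hα' hβ hβ' h
    have hle : domIdem t ≤ domIdem s := mul_inv_mul_self_of_conj h1
    have hsZ : s ∉ Z := fun hsZ => hvZ <| by
      have h2 : (domIdem t).val * s = (domIdem t).val := by
        have h3 : (domIdem s).val = s := (hq.isZero s hsZ).inv_mul_self
        simpa only [h3] using le_iff_mul_eq.1 hle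
      rwa [← h2, (hq.isZero s hsZ _).2]
    have hd : domIdem s = domIdem t := le_antisymm (hmax ⟨hs, hsZ⟩ hle) hle
    have hr : ranIdem s ≤ ranIdem t := mul_inv_self_mul_of_conj h1 (congrArg Idem.val hd)
    exact ⟨hd, le_antisymm hr (hmin ⟨⟨hs, hsZ⟩, hd⟩ hr)⟩
  have hloc : ∀ s, b.coeff s ≠ 0 → IsLocal e (α⁻¹ * s * β) := fun s hs => by
    refine ⟨by rw [← mul_assoc, ← mul_assoc, heα], by rw [mul_assoc, hβe], fun h => ?_⟩
    obtain ⟨h1, h2⟩ := key s hs h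
    have h1' : s * (domIdem t).val = s := by rw [← h1, domIdem, ← mul_assoc, mul_inv_mul]
    calc α⁻¹ * s * β * (α⁻¹ * s * β)⁻¹ = α⁻¹ * (s * (β * β⁻¹) * s⁻¹) * α := by
          rw [mul_inv_rev', mul_inv_rev', inv_inv']; simp only [mul_assoc]
      _ = e.val := by
          rw [hβ', h1', show s * s⁻¹ = (ranIdem t).val from congrArg Idem.val h2, hαu, hα]
  have hrec : ∀ s, b.coeff s ≠ 0 → (α⁻¹ * s * β)⁻¹ * (α⁻¹ * s * β) = e.val →
      α * (α⁻¹ * s * β) * β⁻¹ = s := fun s hs h => by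
    obtain ⟨h1, h2⟩ := key s hs h
    calc α * (α⁻¹ * s * β) * β⁻¹ = α * α⁻¹ * s * (β * β⁻¹) := by simp only [mul_assoc]
      _ = s := by
        rw [hα', hβ', ← h1, ← h2, ranIdem, domIdem, mul_inv_mul, ← mul_assoc, mul_inv_mul]
  have htg : (α⁻¹ * t * β)⁻¹ * (α⁻¹ * t * β) = e.val := by
    calc (α⁻¹ * t * β)⁻¹ * (α⁻¹ * t * β) = β⁻¹ * (t⁻¹ * (α * α⁻¹) * t) * β := by
          rw [mul_inv_rev', mul_inv_rev', inv_inv']; simp only [mul_assoc]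
      _ = β⁻¹ * (domIdem t).val * β := by
          rw [hα', ranIdem, domIdem, ← mul_assoc t⁻¹ t, inv_mul_inv]
      _ = e.val := by rw [← hβ', ← mul_assoc, inv_mul_inv, hβ]
  refine ⟨single α⁻¹ 1, single β 1, ?_, fun h0 => hbt ?_⟩
  · rw [single_mul_mul_single]
    exact sum_mem fun s hs => single_mem_localSpan (hloc s (Finsupp.mem_support_iff.1 hs)) _
  · have h1 := coeff_groupPart (R := R) e (single α⁻¹ 1 * b * single β 1)
      ⟨α⁻¹ * t * β, htg, (hloc t hbt).ran htg⟩
    rw [h0, single_mul_mul_single, coeff_finsuppSum, Finsupp.sum, Finsupp.finsetSum_apply,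
      Finset.sum_eq_single t] at h1
    · simpa using h1.symm
    · intro s hs hst
      rw [coeff_single, Finsupp.single_apply, if_neg]
      intro h2
      have hs' := Finsupp.mem_support_iff.1 hs
      refine hst ?_
      rw [← hrec s hs' (by rw [h2, htg]), h2, hrec t hbt htg]
    · intro h2
      simpa using h2

/-- If the idempotents off `Z` form one `𝒟`-class with a prime maximal subgroup algebra, then the
contraction is prime. -/
theorem IsContraction.isPrimeRing (hq : IsContraction Z q) (hS : IsBisimpleOff Z)
    {e : Idem S} (he : e.val ∉ Z) (hG : IsPrimeRing (MonoidAlgebra R (MaximalSubgroup e))) :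
    IsPrimeRing A := by
  have : Nontrivial A := by
    obtain ⟨w, hw⟩ := @exists_ne _ hG.1 0
    refine ⟨q (groupIncl R e w), 0, fun h => hw ?_⟩
    rw [← groupPart_groupIncl e w, hq.groupPart_eq_zero he h]
  refine isPrimeRing_of_eq_zero_or_eq_zero fun a' b' h => ?_
  obtain ⟨a, rfl⟩ := hq.surj a'
  obtain ⟨b, rfl⟩ := hq.surj b'
  by_contra! hab
  obtain ⟨x, y, hx, hx'⟩ := hq.exists_compress hS he hab.1
  obtain ⟨x', y', hy, hy'⟩ := hq.exists_compress hS he hab.2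
  refine (hG.eq_zero_or_eq_zero fun w => ?_).elim hx' hy'
  have h1 := mul_mem_localSpan_and_groupPart_mul hx (groupIncl_mem_localSpan e w)
  have h2 := mul_mem_localSpan_and_groupPart_mul h1.1 hy
  rw [h1.2, groupPart_groupIncl] at h2
  rw [← h2.2]
  refine hq.groupPart_eq_zero he ?_
  calc q (x * a * y * groupIncl R e w * (x' * b * y'))
      = q x * (q a * q (y * groupIncl R e w * x') * q b) * q y' := by
        simp only [← map_mul, mul_assoc]
    _ = 0 := by rw [h, mul_zero, zero_mul]


/-! ### The isolating idempotent of a pseudofinite semilattice -/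

variable (R) in
/-- The linear combinations of idempotents strictly below `e`. -/
noncomputable def belowSpan (e : Idem S) : AddSubgroup (MonoidAlgebra R S) :=
  AddSubgroup.closure {x | ∃ f : Idem S, ∃ r, f < e ∧ single f.val r = x}

theorem single_mem_belowSpan {e f : Idem S} (hf : f < e) (r : R) :
    single f.val r ∈ belowSpan R e :=
  AddSubgroup.subset_closure ⟨f, r, hf, rfl⟩

theorem belowSpan_le_localSpan (e : Idem S) : belowSpan R e ≤ localSpan R e := by
  refine (AddSubgroup.closure_le _).2 ?_
  rintro _ ⟨f, r, hf, rfl⟩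
  exact single_mem_localSpan (Idem.isLocal hf.le) r

theorem groupPart_eq_zero_of_mem_belowSpan {e : Idem S} {c : MonoidAlgebra R S}
    (hc : c ∈ belowSpan R e) : groupPart R e c = 0 := by
  induction hc using AddSubgroup.closure_induction with
  | zero => rw [map_zero]
  | add x y _ _ hx hy => rw [map_add, hx, hy, add_zero]
  | neg x _ hx => rw [map_neg, hx, neg_zero]
  | mem x hx =>
    obtain ⟨f, r, hf, rfl⟩ := hx
    refine groupPart_single_of_ne (fun h => hf.ne (Idem.ext ?_)) r
    rwa [inv_of_idem f.mul_self, f.mul_self] at h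

/-- Elements of `RE(S)` commute with idempotents, and multiplying by one keeps them below `e`. -/
theorem mul_single_of_mem_belowSpan {e : Idem S} {c : MonoidAlgebra R S}
    (hc : c ∈ belowSpan R e) (f : Idem S) :
    c * single f.val 1 ∈ belowSpan R e ∧ single f.val 1 * c = c * single f.val 1 := by
  induction hc using AddSubgroup.closure_induction with
  | zero => simp only [mul_zero, zero_mul, zero_mem, and_self]
  | add x y _ _ hx hy =>
    rw [mul_add, add_mul, hx.2, hy.2]
    exact ⟨add_mem hx.1 hy.1, rfl⟩
  | neg x _ hx =>
    rw [mul_neg, neg_mul, hx.2]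
    exact ⟨neg_mem hx.1, rfl⟩
  | mem x hx =>
    obtain ⟨g, r, hg, rfl⟩ := hx
    rw [single_mul_single, single_mul_single, idem_comm f.mul_self g.mul_self, mul_comm r]
    refine ⟨single_mem_belowSpan (f := ⟨g.val * f.val, mul_idem g.mul_self f.mul_self⟩) ?_ _, rfl⟩
    refine lt_of_le_of_lt (b := g) ?_ hg
    rw [le_iff_mul_eq']
    exact by rw [← mul_assoc, g.mul_self]

/-- `d = e - c` for a linear combination `c` of idempotents below `e`, and `d` annihilates all
idempotents below `e`. Then `d` is an idempotent with `d RS d = d RG_e`. -/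
structure IsIsolating (e : Idem S) (d : MonoidAlgebra R S) : Prop where
  val_sub_mem : single e.val 1 - d ∈ belowSpan R e
  mul_below : ∀ f < e, d * single f.val 1 = 0
  below_mul : ∀ f < e, single f.val 1 * d = 0

theorem mul_val_of_mem_belowSpan {e : Idem S} {c : MonoidAlgebra R S} (hc : c ∈ belowSpan R e) :
    c * single e.val 1 = c := by
  induction hc using AddSubgroup.closure_induction with
  | zero => rw [zero_mul]
  | add x y _ _ hx hy => rw [add_mul, hx, hy]
  | neg x _ hx => rw [neg_mul, hx]
  | mem x hx =>
    obtain ⟨f, r, hf, rfl⟩ := hx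
    rw [single_mul_single, mul_one, le_iff_mul_eq.1 hf.le]

/-- Multiply `e` by all the `e - f`, for `f` in a finite set of idempotents below `e`. -/
theorem exists_annihilating (e : Idem S) (F : Finset (Idem S)) (hF : ∀ f ∈ F, f < e) :
    ∃ d : MonoidAlgebra R S, single e.val 1 - d ∈ belowSpan R e ∧
      ∀ f ∈ F, d * single f.val 1 = 0 := by
  classical
  induction F using Finset.induction_on with
  | empty => exact ⟨single e.val 1, by simp [zero_mem], by simp⟩
  | insert f F _ ih =>
    obtain ⟨d, hd, hdF⟩ := ih fun g hg => hF g (Finset.mem_insert_of_mem hg)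
    have hf := hF f (Finset.mem_insert_self f F)
    refine ⟨d - d * single f.val 1, ?_, fun g hg => ?_⟩
    · have h1 : d * single f.val 1 = single f.val 1 - (single e.val 1 - d) * single f.val 1 := by
        rw [sub_mul, single_mul_single, le_iff_mul_eq'.1 hf.le, mul_one]; abel
      rw [← sub_add, h1]
      exact add_mem hd
        (sub_mem (single_mem_belowSpan hf 1) (mul_single_of_mem_belowSpan hd f).1)
    · rcases Finset.mem_insert.1 hg with rfl | hg
      · rw [sub_mul, mul_assoc, single_mul_single, g.mul_self, mul_one, sub_self]
      · rw [sub_mul, hdF g hg, mul_assoc, single_mul_single, idem_comm f.mul_self g.mul_self,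
          ← single_mul_single, ← mul_assoc, hdF g hg, zero_mul, sub_zero]

theorem exists_isIsolating (hE : IsPseudofinite (Idem S)) (e : Idem S) :
    ∃ d : MonoidAlgebra R S, IsIsolating e d := by
  obtain ⟨F, hF⟩ := hE e
  have hmem : ∀ f, f < e ↔ ∃ g ∈ F, f ≤ g := fun f => by
    rw [← Set.mem_Iio, hF]; simp
  obtain ⟨d, hd, hdF⟩ := exists_annihilating (R := R) e F fun f hf => (hmem f).2 ⟨f, hf, le_rfl⟩
  have h1 : ∀ f < e, d * single f.val 1 = 0 := fun f hf => by
    obtain ⟨g, hg, hfg⟩ := (hmem f).1 hf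
    rw [← le_iff_mul_eq'.1 hfg, ← mul_one (1 : R), ← single_mul_single, ← mul_assoc, hdF g hg,
      zero_mul]
  refine ⟨d, hd, h1, fun f hf => ?_⟩
  have h2 := (mul_single_of_mem_belowSpan hd f).2
  rw [mul_sub, sub_mul, h1 f hf, single_mul_single, single_mul_single, le_iff_mul_eq'.1 hf.le,
    le_iff_mul_eq.1 hf.le, sub_zero] at h2
  exact sub_eq_self.1 h2

namespace IsIsolating

variable {e f : Idem S} {d d' : MonoidAlgebra R S}

theorem groupPart_eq_one (hd : IsIsolating e d) : groupPart R e d = 1 := by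
  have h := groupPart_eq_zero_of_mem_belowSpan hd.val_sub_mem
  rw [map_sub, sub_eq_zero] at h
  rw [← h, one_def]
  exact groupPart_single_val (1 : MaximalSubgroup e) 1

theorem mem_localSpan (hd : IsIsolating e d) : d ∈ localSpan R e := by
  have h := sub_mem (single_mem_localSpan (Idem.isLocal le_rfl) (1 : R))
    (belowSpan_le_localSpan e hd.val_sub_mem)
  rwa [sub_sub_cancel] at h

theorem mul_val (hd : IsIsolating e d) : d * single e.val 1 = d := by
  have h := mul_val_of_mem_belowSpan hd.val_sub_mem
  rwa [sub_mul, single_mul_single, e.mul_self, mul_one, sub_right_inj] at h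

theorem val_mul (hd : IsIsolating e d) : single e.val 1 * d = d := by
  have h := (mul_single_of_mem_belowSpan hd.val_sub_mem e).2
  rwa [mul_sub, sub_mul, hd.mul_val, sub_right_inj] at h

theorem mul_single_eq_zero (hd : IsIsolating e d) {s : S} (hs : e.val * s = s)
    (h : s * s⁻¹ ≠ e.val) (r : R) : d * single s r = 0 := by
  have h1 := hd.mul_below (ranIdem s)
    (lt_of_le_of_ne (ranIdem_le hs) fun h2 => h (congrArg Idem.val h2))
  have h2 : single s r = single (ranIdem s).val 1 * single s r := by
    rw [single_mul_single, one_mul, ranIdem, mul_inv_mul]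
  rw [h2, ← mul_assoc, h1, zero_mul]

theorem single_mul_eq_zero (hd : IsIsolating e d) {s : S} (hs : s * e.val = s)
    (h : s⁻¹ * s ≠ e.val) (r : R) : single s r * d = 0 := by
  have h1 := hd.below_mul (domIdem s)
    (lt_of_le_of_ne (domIdem_le hs) fun h2 => h (congrArg Idem.val h2))
  have h2 : single s r = single s r * single (domIdem s).val 1 := by
    rw [single_mul_single, mul_one, domIdem, ← mul_assoc, mul_inv_mul]
  rw [h2, mul_assoc, h1, mul_zero]

theorem mul_single_mul (hd : IsIsolating e d) (hd' : IsIsolating f d') (s : S) (r : R) :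
    d * single s r * d' = d * single (e.val * s * f.val) r * d' := by
  conv_lhs => rw [← hd.mul_val, ← hd'.val_mul]
  simp only [mul_assoc, ← mul_assoc (single _ _) (single _ _), single_mul_single, one_mul, mul_one]

/-- Between isolating idempotents of `e` and `f` only elements from `f` to `e` survive. -/
theorem mul_single_mul_eq_zero (hd : IsIsolating e d) (hd' : IsIsolating f d') (s : S) (r : R)
    (h : (e.val * s * f.val) * (e.val * s * f.val)⁻¹ = e.val →
      (e.val * s * f.val)⁻¹ * (e.val * s * f.val) ≠ f.val) : d * single s r * d' = 0 := by
  rw [hd.mul_single_mul hd']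
  by_cases h1 : (e.val * s * f.val) * (e.val * s * f.val)⁻¹ = e.val
  · rw [mul_assoc, hd'.single_mul_eq_zero (by rw [mul_assoc, f.mul_self]) (h h1), mul_zero]
  · rw [hd.mul_single_eq_zero (by rw [← mul_assoc, ← mul_assoc, e.mul_self]) h1, zero_mul]

theorem commute_single (hd : IsIsolating e d) (g : MaximalSubgroup e) (r : R) :
    single g.val r * d = d * single g.val r := by
  -- Both sides agree with `d * g * d`, as `G_e` permutes the idempotents below `e`.
  have h1 : ∀ c ∈ belowSpan R e, c * (single g.val r * d) = 0 := fun c hc => by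
    induction hc using AddSubgroup.closure_induction with
    | zero => rw [zero_mul]
    | add x y _ _ hx hy => rw [add_mul, hx, hy, add_zero]
    | neg x _ hx => rw [neg_mul, hx, neg_zero]
    | mem x hx =>
      obtain ⟨f, r', hf, rfl⟩ := hx
      rw [← mul_assoc, single_mul_single]
      refine hd.single_mul_eq_zero (by rw [mul_assoc, g.mul_one']) (fun h => ?_) _
      have h2 := (g⁻¹.conj_lt hf).ne
      refine h2 (Idem.ext ?_)
      change g.val⁻¹ * f.val * g.val⁻¹⁻¹ = e.val
      rw [← h, mul_inv_rev', inv_inv', inv_of_idem f.mul_self, mul_assoc, mul_assoc,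
        ← mul_assoc f.val f.val, f.mul_self]
  have h2 : ∀ c ∈ belowSpan R e, d * single g.val r * c = 0 := fun c hc => by
    induction hc using AddSubgroup.closure_induction with
    | zero => rw [mul_zero]
    | add x y _ _ hx hy => rw [mul_add, hx, hy, add_zero]
    | neg x _ hx => rw [mul_neg, hx, neg_zero]
    | mem x hx =>
      obtain ⟨f, r', hf, rfl⟩ := hx
      rw [mul_assoc, single_mul_single]
      refine hd.mul_single_eq_zero (by rw [← mul_assoc, g.one_mul']) (fun h => ?_) _
      refine (g.conj_lt hf).ne (Idem.ext ?_)
      change g.val * f.val * g.val⁻¹ = e.val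
      rw [← h, mul_inv_rev', inv_of_idem f.mul_self, mul_assoc, mul_assoc,
        ← mul_assoc f.val f.val, f.mul_self]
  have h3 := h1 _ hd.val_sub_mem
  have h4 := h2 _ hd.val_sub_mem
  rw [sub_mul, ← mul_assoc, single_mul_single, one_mul, g.one_mul', sub_eq_zero] at h3
  rw [mul_sub, mul_assoc, single_mul_single, mul_one, g.mul_one', sub_eq_zero] at h4
  rw [h3, h4, mul_assoc]

theorem commute_groupIncl (hd : IsIsolating e d) (w : MonoidAlgebra R (MaximalSubgroup e)) :
    groupIncl R e w * d = d * groupIncl R e w := by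
  induction w using induction_linear with
  | zero => rw [map_zero, zero_mul, mul_zero]
  | add x y hx hy => rw [map_add, add_mul, mul_add, hx, hy]
  | single g r => rw [groupIncl_single, hd.commute_single]

theorem mul_self (hd : IsIsolating e d) : d * d = d := by
  have h : ∀ c ∈ belowSpan R e, c * d = 0 := fun c hc => by
    induction hc using AddSubgroup.closure_induction with
    | zero => rw [zero_mul]
    | add x y _ _ hx hy => rw [add_mul, hx, hy, add_zero]
    | neg x _ hx => rw [neg_mul, hx, neg_zero]
    | mem x hx =>
      obtain ⟨f, r, hf, rfl⟩ := hx
      rw [← mul_one r, ← f.mul_self, ← single_mul_single, mul_assoc, hd.below_mul f hf, mul_zero]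
  have h1 := h _ hd.val_sub_mem
  rwa [sub_mul, hd.val_mul, sub_eq_zero, eq_comm] at h1

/-- `d RS d = d RG_e`. -/
theorem exists_mul_mul_eq (hd : IsIsolating e d) (x : MonoidAlgebra R S) :
    ∃ w, d * x * d = groupIncl R e w * d := by
  induction x using induction_linear with
  | zero => exact ⟨0, by rw [mul_zero, map_zero]⟩
  | add x y hx hy =>
    obtain ⟨v, hv⟩ := hx
    obtain ⟨w, hw⟩ := hy
    exact ⟨v + w, by rw [mul_add, add_mul, hv, hw, map_add, add_mul]⟩
  | single s r =>
    by_cases h : (e.val * s * e.val)⁻¹ * (e.val * s * e.val) = e.val ∧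
        (e.val * s * e.val) * (e.val * s * e.val)⁻¹ = e.val
    · let g : MaximalSubgroup e := ⟨_, h.1, h.2⟩
      refine ⟨single g r, ?_⟩
      rw [groupIncl_single, hd.mul_single_mul hd]
      change d * single g.val r * d = _
      rw [← hd.commute_single, mul_assoc, hd.mul_self]
    · exact ⟨0, by rw [hd.mul_single_mul_eq_zero hd s r (by tauto), map_zero, zero_mul]⟩

theorem map_ne_zero [Nontrivial R] (hd : IsIsolating e d) (hq : IsContraction Z q)
    (he : e.val ∉ Z) : q d ≠ 0 := fun h => by
  have h1 := hq.groupPart_eq_zero he h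
  rw [hd.groupPart_eq_one] at h1
  exact one_ne_zero h1

end IsIsolating

/-! ### Prime contractions -/

theorem IsContraction.exists_notMem [Nontrivial A] (hq : IsContraction Z q) :
    ∃ e : Idem S, e.val ∉ Z := by
  obtain ⟨a, ha⟩ := exists_ne (0 : A)
  obtain ⟨x, rfl⟩ := hq.surj a
  rw [Ne, hq.map_eq_zero_iff] at ha
  push Not at ha
  obtain ⟨s, hs, -⟩ := ha
  exact ⟨domIdem s, hq.domIdem_notMem hs⟩

theorem IsContraction.nontrivial [Nontrivial A] (hq : IsContraction Z q) : Nontrivial R := by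
  by_contra h
  rw [not_nontrivial_iff_subsingleton] at h
  obtain ⟨a, ha⟩ := exists_ne (0 : A)
  obtain ⟨x, rfl⟩ := hq.surj a
  exact ha ((hq.map_eq_zero_iff x).2 fun s _ => Subsingleton.elim _ _)

theorem IsContraction.isBisimpleOff (hq : IsContraction Z q) (hE : IsPseudofinite (Idem S))
    (hA : IsPrimeRing A) : IsBisimpleOff Z := fun e f he hf => by
  have := hA.1
  have := hq.nontrivial
  obtain ⟨d, hd⟩ := exists_isIsolating (R := R) hE f
  obtain ⟨d', hd'⟩ := exists_isIsolating (R := R) hE e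
  by_contra! hef
  have h : ∀ x, d * x * d' = 0 := fun x => by
    induction x using induction_linear with
    | zero => rw [mul_zero, zero_mul]
    | add x y hx hy => rw [mul_add, add_mul, hx, hy, add_zero]
    | single s r => exact hd.mul_single_mul_eq_zero hd' s r fun h1 h2 => hef _ h2 h1
  refine (hA.eq_zero_or_eq_zero fun a => ?_).elim (hd.map_ne_zero hq hf) (hd'.map_ne_zero hq he)
  obtain ⟨x, rfl⟩ := hq.surj a
  rw [← map_mul, ← map_mul, h, map_zero]

theorem IsContraction.isPrimeRing_maximalSubgroup (hq : IsContraction Z q)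
    (hE : IsPseudofinite (Idem S)) (hA : IsPrimeRing A) {e : Idem S} (he : e.val ∉ Z) :
    IsPrimeRing (MonoidAlgebra R (MaximalSubgroup e)) := by
  have := hA.1
  have := hq.nontrivial
  obtain ⟨d, hd⟩ := exists_isIsolating (R := R) hE e
  have key : ∀ x, q (groupIncl R e x * d) = 0 → x = 0 := fun x hx => by
    have h1 := hq.groupPart_eq_zero he hx
    rwa [(mul_mem_localSpan_and_groupPart_mul (groupIncl_mem_localSpan e x) hd.mem_localSpan).2,
      hd.groupPart_eq_one, groupPart_groupIncl, mul_one] at h1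
  refine isPrimeRing_of_eq_zero_or_eq_zero fun x y hxy => ?_
  refine (hA.eq_zero_or_eq_zero (a := q (groupIncl R e x * d)) (b := q (groupIncl R e y * d))
    fun a => ?_).imp (key x) (key y)
  obtain ⟨s, rfl⟩ := hq.surj a
  obtain ⟨w, hw⟩ := hd.exists_mul_mul_eq s
  rw [← map_mul, ← map_mul]
  have h : groupIncl R e x * d * s * (groupIncl R e y * d) = 0 := by
    calc groupIncl R e x * d * s * (groupIncl R e y * d)
        = groupIncl R e x * (d * s * d) * groupIncl R e y := by
          rw [hd.commute_groupIncl y]; simp only [mul_assoc]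
      _ = groupIncl R e (x * w * y) * d := by
          rw [hw, map_mul, map_mul, mul_assoc, mul_assoc, ← hd.commute_groupIncl]
          simp only [mul_assoc]
      _ = 0 := by rw [hxy, map_zero, zero_mul]
  rw [h, map_zero]

/-! ### The semigroup algebra and the contracted semigroup algebra -/

theorem isContraction_id :
    IsContraction (∅ : Set S) (NonUnitalRingHom.id (MonoidAlgebra R S)) where
  isZero _ h := h.elim
  surj := Function.surjective_id
  map_eq_zero_iff x := by
    refine ⟨fun h s _ => ?_, fun h => ?_⟩
    · rw [show x = 0 from h, coeff_zero, Finsupp.zero_apply]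
    · ext s
      exact h s (Set.notMem_empty s)

variable (R) in
/-- The quotient map `RS → R₀S`. -/
noncomputable def toContracted {z : S} (hz : IsZeroElement z) :
    MonoidAlgebra R S →ₙ+* ContractedAlgebra R hz where
  toFun x := (x : (zeroIdeal R hz).ringCon.Quotient)
  map_zero' := rfl
  map_add' _ _ := rfl
  map_mul' _ _ := rfl

theorem isContraction_toContracted {z : S} (hz : IsZeroElement z) :
    IsContraction {z} (toContracted R hz) where
  isZero := by rintro _ rfl; exact hz
  surj := Quotient.mk''_surjective
  map_eq_zero_iff x := by
    have h1 : toContracted R hz x = 0 ↔ x ∈ zeroIdeal R hz := RingCon.eq _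
    rw [h1, mem_zeroIdeal]
    refine ⟨?_, fun h => ⟨x.coeff z, ?_⟩⟩
    · rintro ⟨r, rfl⟩ s hs
      rw [coeff_single, Finsupp.single_eq_of_ne hs]
    · ext s
      by_cases hs : s = z
      · rw [hs, coeff_single, Finsupp.single_eq_same]
      · rw [coeff_single, Finsupp.single_eq_of_ne hs, h s hs]

end Algebra

end InverseSemigroup


theorem theoremt {S : Type*} [InverseSemigroup S] {R : Type*} [CommRing R] :
    -- the semigroup algebra `RS`
    ((∀ e : InverseSemigroup.Idem S, InverseSemigroup.IsBisimple S →
        IsPrimeRing (MonoidAlgebra R (InverseSemigroup.MaximalSubgroup e)) →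
        IsPrimeRing (MonoidAlgebra R S)) ∧
      (IsPseudofinite (InverseSemigroup.Idem S) → IsPrimeRing (MonoidAlgebra R S) →
        InverseSemigroup.IsBisimple S ∧ Nonempty (InverseSemigroup.Idem S) ∧
          ∀ e : InverseSemigroup.Idem S,
            IsPrimeRing (MonoidAlgebra R (InverseSemigroup.MaximalSubgroup e)))) ∧
    -- the contracted semigroup algebra `R₀S`, when `S` has a zero element `z`
    (∀ (z : S) (hz : InverseSemigroup.IsZeroElement z),
      (∀ e : InverseSemigroup.Idem S, e.val ≠ z → InverseSemigroup.IsZeroBisimple z →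
        IsPrimeRing (MonoidAlgebra R (InverseSemigroup.MaximalSubgroup e)) →
        IsPrimeRing (InverseSemigroup.ContractedAlgebra R hz)) ∧
      (IsPseudofinite (InverseSemigroup.Idem S) →
        IsPrimeRing (InverseSemigroup.ContractedAlgebra R hz) →
        InverseSemigroup.IsZeroBisimple z ∧ (∃ e : InverseSemigroup.Idem S, e.val ≠ z) ∧
          ∀ e : InverseSemigroup.Idem S, e.val ≠ z →
            IsPrimeRing (MonoidAlgebra R (InverseSemigroup.MaximalSubgroup e)))) := by
  refine ⟨⟨fun e hS hG => ?_, fun hE hA => ?_⟩, fun z hz => ⟨fun e he hS hG => ?_, fun hE hA => ?_⟩⟩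
  · exact InverseSemigroup.isContraction_id.isPrimeRing (fun e f _ _ => hS e f)
      (Set.notMem_empty e.val) hG
  · have hq := InverseSemigroup.isContraction_id (S := S) (R := R)
    have := hA.1
    exact ⟨fun e f => hq.isBisimpleOff hE hA e f (Set.notMem_empty _) (Set.notMem_empty _),
      hq.exists_notMem.nonempty, fun e => hq.isPrimeRing_maximalSubgroup hE hA (Set.notMem_empty _)⟩
  · exact (InverseSemigroup.isContraction_toContracted hz).isPrimeRing hS he hG
  · have hq := InverseSemigroup.isContraction_toContracted (R := R) hz
    have := hA.1
    exact ⟨hq.isBisimpleOff hE hA, hq.exists_notMem, fun e => hq.isPrimeRing_maximalSubgroup hE hA⟩
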